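/- Let $n,d\ge 1$ and let $V\subset\mathbb P^n(\mathbb C)$ be a projective subvariety (a Zariski closed subset, irreducible or not) of dimension $k$ with $1\le k\le n$. Let $I(V)\subset\mathbb C[x_0,\dots,x_n]$ be its homogeneous ideal, $H_d$ the space of homogeneous polynomials of degree $d$ in $x_0,\dots,x_n$ (including $0$), and $I_d(V)=H_d/(I(V)\cap H_d)$. Let $Q_1,\dots,Q_q$, $q\ge k+1$, be hypersurfaces of common degree $d$ in $\mathbb P^n(\mathbb C)$, given by homogeneous polynomials $Q_i\in H_d$, none of them containing $V$. For $R\subset\{1,\dots,q\}$ let $\operatorname{rank}\{Q_i\}_{i\in R}$ be the dimension of the linear span of the classes $[Q_i]$, $i\in R$, in $I_d(V)$. Assume that the family is in $N$-subgeneral position with respect to $V$, that is, $V\cap\bigcap_{i\in R}Q_i=\varnothing$ for every $R\subset\{1,\dots,q\}$ with $|R|=N+1$, and that $q>2N-k+1$. Then there are rational numbers $\omega_1,\dots,\omega_q$ such that, with $\tilde\omega=\max_{1\le j\le q}\omega_j$: (i) $0<\omega_i\le 1$ for every $i$; (ii) $\sum_{j=1}^q\omega_j=\tilde\omega\,(q-2N+k-1)+k+1$;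 (iii) $\dfrac{k+1}{2N-k+1}\le\tilde\omega\le\dfrac kN$; (iv) $\sum_{i\in R}\omega_i\le k+1$ for every $R\subset\{1,\dots,q\}$ with $|R|=N+1$; (v) for all real numbers $E_1,\dots,E_q\ge 1$ and every $R\subset\{1,\dots,q\}$ with $|R|=N+1$ there is a subset $R^\circ\subset R$ (which may depend on the $E_i$) with $|R^\circ|=\operatorname{rank}\{Q_i\}_{i\in R^\circ}=k+1$ and $$\prod_{i\in R}E_i^{\omega_i}\le\prod_{i\in R^\circ}E_i .$$ -/

import Mathlib

open scoped LinearAlgebra.Projectivization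

namespace NochkaWeights

noncomputable section

/-- The set of points of complex projective `n`-space; it carries the Zariski topology below. -/
def ProjSpace (n : ℕ) : Type := ℙ ℂ (Fin (n + 1) → ℂ)

/-- The polynomial `f` vanishes at `p`, i.e. at every vector of homogeneous coordinates of `p`.
For homogeneous `f` one such vector suffices. -/
def VanishesAt {n : ℕ} (f : MvPolynomial (Fin (n + 1)) ℂ) (p : ProjSpace n) : Prop :=
  ∀ (v : Fin (n + 1) → ℂ) (hv : v ≠ 0), Projectivization.mk ℂ v hv = p →
    MvPolynomial.eval v f = 0

/-- The zero set in projective space of a polynomial (used for homogeneous polynomials). -/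
def hypersurface {n : ℕ} (f : MvPolynomial (Fin (n + 1)) ℂ) : Set (ProjSpace n) :=
  {p | VanishesAt f p}

/-- The Zariski topology: the complements of the zero sets of homogeneous polynomials
are a basis of open sets, so the closed sets are the projective algebraic sets. -/
instance zariskiTopology (n : ℕ) : TopologicalSpace (ProjSpace n) :=
  TopologicalSpace.generateFrom
    {U | ∃ (d : ℕ) (f : MvPolynomial (Fin (n + 1)) ℂ),
      f.IsHomogeneous d ∧ U = (hypersurface f)ᶜ}

/-- The homogeneous ideal `I(V)` of a subset `V` of projective space. -/
def vanishingIdeal {n : ℕ} (V : Set (ProjSpace n)) : Ideal (MvPolynomial (Fin (n + 1)) ℂ) where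
  carrier := {f | ∀ p ∈ V, VanishesAt f p}
  zero_mem' := fun p _ v hv _ => map_zero _
  add_mem' := fun {f g} hf hg p hp v hv hvp => by
    rw [map_add, hf p hp v hv hvp, hg p hp v hv hvp, add_zero]
  smul_mem' := fun c f hf p hp v hv hvp => by
    rw [smul_eq_mul, map_mul, hf p hp v hv hvp, mul_zero]

/-- The space `H_d` of homogeneous polynomials of degree `d` in `n + 1` variables
(together with `0`). -/
abbrev Forms (n d : ℕ) : Type := MvPolynomial.homogeneousSubmodule (Fin (n + 1)) ℂ d

/-- `I(V) ∩ H_d`, as a subspace of `H_d`. -/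
def vanishingForms {n : ℕ} (V : Set (ProjSpace n)) (d : ℕ) : Submodule ℂ (Forms n d) :=
  ((vanishingIdeal V).restrictScalars ℂ).comap
    (MvPolynomial.homogeneousSubmodule (Fin (n + 1)) ℂ d).subtype

/-- `I_d(V) = H_d / (I(V) ∩ H_d)`. -/
abbrev FormsOn {n : ℕ} (V : Set (ProjSpace n)) (d : ℕ) : Type :=
  Forms n d ⧸ vanishingForms V d

/-- The rank of `{Q_i}_{i ∈ R}`: the dimension of the span of the classes `[Q_i]`, `i ∈ R`,
in `I_d(V)`. -/
def rankOn {n d q : ℕ} (V : Set (ProjSpace n)) (Q : Fin q → Forms n d) (R : Finset (Fin q)) : ℕ :=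
  Module.finrank ℂ
    (Submodule.span ℂ ((fun i => (Submodule.Quotient.mk (Q i) : FormsOn V d)) '' (R : Set (Fin q))))

/-- `N`-subgeneral position with respect to `V`: any `N + 1` of the hypersurfaces (with distinct
indices) have no common point on `V`. -/
def InSubgeneralPosition {n d q : ℕ} (N : ℕ) (V : Set (ProjSpace n)) (Q : Fin q → Forms n d) :
    Prop :=
  ∀ R : Finset (Fin q), R.card = N + 1 →
    V ∩ ⋂ i ∈ R, hypersurface (Q i : MvPolynomial (Fin (n + 1)) ℂ) = ∅

end

end NochkaWeights

/-! ### Matroid rank functions, the greedy algorithm and tight weights -/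

namespace NochkaWeights

open Finset

/-! The ranks of the classes `[Q_i]` are those of a matroid. Geometry enters through one fact: any
`N + 1` hypersurfaces have rank at least `k + 1`. Otherwise a basis of their span, having at most
`k` forms, would have a common zero on `V` by Krull's height theorem (`exists_common_zero`), and the
whole span would vanish there. Truncating at `k + 1` leaves a loopless matroid `ρ` of rank `k + 1`
in which all `(N + 1)`-sets span.

For such `ρ`, take `S` of rank at most `k` maximizing the slope `t` of the line from `(#S, ρ S)` to
`(2N - k + 1, k + 1)`. Elements outside `S` get weight `t`; those in `S` get weights at most `t`, of
total `ρ S` and bounded by `ρ` on every subset of `S` (`exists_tight_weight`). Maximality of `t` and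
submodularity give `ω(R) ≤ ρ R` whenever `#R ≤ N + 1` (`exists_nochka_weights`). This bound contains
(iv), and the greedy algorithm with values `log E_i` turns it into (v) (`exists_greedy_basis`). -/

/-- The axioms of the rank function of a matroid on a finite ground set. -/
structure IsRankFunction {ι : Type*} [DecidableEq ι] (ρ : Finset ι → ℕ) : Prop where
  empty : ρ ∅ = 0
  mono : ∀ {S T : Finset ι}, S ⊆ T → ρ S ≤ ρ T
  insert_le : ∀ (i : ι) (S : Finset ι), ρ (insert i S) ≤ ρ S + 1
  submod : ∀ S T : Finset ι, ρ (S ∪ T) + ρ (S ∩ T) ≤ ρ S + ρ T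

namespace IsRankFunction

variable {ι : Type*} [DecidableEq ι] {ρ : Finset ι → ℕ}

theorem le_card (hρ : IsRankFunction ρ) (S : Finset ι) : ρ S ≤ #S := by
  induction S using Finset.induction_on with
  | empty => simp [hρ.empty]
  | insert i S hi ih => rw [card_insert_of_notMem hi]; linarith [hρ.insert_le i S]

theorem truncate (hρ : IsRankFunction ρ) (m : ℕ) : IsRankFunction fun S => min (ρ S) m where
  empty := by simp [hρ.empty]
  mono h := min_le_min_right _ (hρ.mono h)
  insert_le i S := by have := hρ.insert_le i S; omega
  submod S T := by
    have := hρ.submod S T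
    have := hρ.mono (subset_union_left : S ⊆ S ∪ T)
    have := hρ.mono (subset_union_right : T ⊆ S ∪ T)
    have := hρ.mono (inter_subset_left : S ∩ T ⊆ S)
    have := hρ.mono (inter_subset_right : S ∩ T ⊆ T)
    omega

theorem union_le_of_insert_le (hρ : IsRankFunction ρ) {S : Finset ι}
    (h : ∀ i, ρ (insert i S) ≤ ρ S) (T : Finset ι) : ρ (S ∪ T) ≤ ρ S := by
  induction T using Finset.induction_on with
  | empty => simp
  | insert i T _ ih =>
    have h1 := hρ.submod (S ∪ T) (insert i S)
    have h2 : S ∪ T ∪ insert i S = S ∪ insert i T := by ext; simp; tauto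
    have h3 : ρ S ≤ ρ ((S ∪ T) ∩ insert i S) :=
      hρ.mono (subset_inter subset_union_left (subset_insert _ _))
    rw [h2] at h1
    have := h i
    omega

/-- The greedy algorithm: if the weights `w` of subsets of `R` are bounded by their ranks, then
some basis of `R` has total value at least the `w`-weighted total value of `R`. -/
theorem exists_greedy_basis (hρ : IsRankFunction ρ) (w a : ι → ℝ) (R : Finset ι)
    (hw : ∀ T ⊆ R, ∑ i ∈ T, w i ≤ ρ T) (c : ℝ) (hc : ∀ i ∈ R, c ≤ a i) :
    ∃ B ⊆ R, ρ B = #B ∧ #B = ρ R ∧ ∑ i ∈ R, w i * (a i - c) ≤ ∑ i ∈ B, (a i - c) := by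
  induction R using Finset.strongInduction generalizing c with
  | H R ih =>
    rcases R.eq_empty_or_nonempty with rfl | hne
    · exact ⟨∅, by simp [hρ.empty]⟩
    -- Remove the least valuable element and raise the level from `c` to `a j`. At the new level `j`
    -- contributes zero, so it can rejoin the basis at no cost.
    obtain ⟨j, hj, hmin⟩ := R.exists_min_image a hne
    obtain ⟨B, hBR, hB, hBc, hle⟩ := ih (R.erase j) (erase_ssubset hj)
      (fun T hT => hw T (hT.trans (erase_subset _ _))) (a j)
      (fun i hi => hmin i (mem_of_mem_erase hi))
    have hjB : j ∉ B := fun h => by simpa using hBR h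
    have hBR' : B ⊆ R := hBR.trans (erase_subset _ _)
    have hins : insert j (R.erase j) = R := insert_erase hj
    obtain ⟨B', hB'R, hB', hB'c, hsum⟩ : ∃ B' ⊆ R, ρ B' = #B' ∧ #B' = ρ R ∧
        ∑ i ∈ B', (a i - a j) = ∑ i ∈ B, (a i - a j) := by
      have h1 := hρ.insert_le j (R.erase j)
      have h2 := hρ.mono (erase_subset j R)
      rw [hins] at h1
      rcases Nat.lt_or_ge (ρ (R.erase j)) (ρ R) with h | h
      · refine ⟨insert j B, insert_subset hj hBR', ?_, ?_, by simp [sum_insert hjB]⟩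
        · have h3 := hρ.submod (insert j B) (R.erase j)
          have h4 : insert j B ∪ R.erase j = R := by
            rw [insert_union, union_eq_right.2 hBR, hins]
          have h5 : ρ B ≤ ρ (insert j B ∩ R.erase j) :=
            hρ.mono (subset_inter (subset_insert _ _) hBR)
          have h6 := hρ.insert_le j B
          rw [h4] at h3
          rw [card_insert_of_notMem hjB]
          omega
        · rw [card_insert_of_notMem hjB]; omega
      · exact ⟨B, hBR', hB, by omega, rfl⟩
    refine ⟨B', hB'R, hB', hB'c, ?_⟩
    -- Abel summation: lowering the level back to `c` adds `(a j - c) w(R)` on the left and `(a j -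
    -- c) ρ R` on the right.
    have e1 : ∑ i ∈ R, w i * (a i - c) =
        ∑ i ∈ R.erase j, w i * (a i - a j) + (a j - c) * ∑ i ∈ R, w i := by
      rw [← add_sum_erase R _ hj, ← add_sum_erase R w hj, mul_add, mul_sum]
      have : ∑ i ∈ R.erase j, w i * (a i - c) = ∑ i ∈ R.erase j, w i * (a i - a j) +
          ∑ i ∈ R.erase j, (a j - c) * w i := by
        rw [← sum_add_distrib]; exact sum_congr rfl fun i _ => by ring
      rw [this]; ring
    have e2 : ∑ i ∈ B', (a i - c) = ∑ i ∈ B', (a i - a j) + (a j - c) * #B' := by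
      rw [mul_comm, ← nsmul_eq_mul, ← sum_const, ← sum_add_distrib]
      exact sum_congr rfl fun i _ => by ring
    have h7 : (a j - c) * ∑ i ∈ R, w i ≤ (a j - c) * #B' :=
      mul_le_mul_of_nonneg_left (by rw [hB'c]; exact hw R Subset.rfl) (by linarith [hc j hj])
    rw [e1, e2, hsum]
    linarith

/-- A vector of the polytope `{y | y ≤ t, y(T) ≤ ρ T for T ⊆ S}` can be increased until each
coordinate in `U` is blocked by one of the constraints. -/
theorem exists_saturated (S : Finset ι) (t : ℚ) (x : ι → ℚ) (hxt : ∀ i, x i ≤ t)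
    (hx : ∀ T ⊆ S, ∑ i ∈ T, x i ≤ ρ T) (U : Finset ι) (hU : U ⊆ S) :
    ∃ y : ι → ℚ, (∀ i, x i ≤ y i) ∧ (∀ i, y i ≤ t) ∧ (∀ T ⊆ S, ∑ i ∈ T, y i ≤ ρ T) ∧
      ∀ i ∈ U, y i = t ∨ ∃ T ⊆ S, i ∈ T ∧ ∑ j ∈ T, y j = ρ T := by
  induction U using Finset.induction_on with
  | empty => exact ⟨x, fun _ => le_rfl, hxt, hx, by simp⟩
  | insert i U hi ih =>
    obtain ⟨y, hxy, hyt, hy, hsat⟩ := ih ((subset_insert _ _).trans hU)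
    have hiS : i ∈ S := hU (mem_insert_self _ _)
    obtain ⟨T₀, hT₀, hmin⟩ := ({T ∈ S.powerset | i ∈ T}).exists_min_image
      (fun T => (ρ T : ℚ) - ∑ j ∈ T, y j) ⟨S, by simp [hiS]⟩
    simp only [mem_filter, mem_powerset] at hT₀ hmin
    -- The largest admissible increase of coordinate `i`; `T₀` has the least slack among the sets
    -- containing `i`.
    set δ : ℚ := min (t - y i) ((ρ T₀ : ℚ) - ∑ j ∈ T₀, y j) with hδ
    have hδ0 : 0 ≤ δ := le_min (by linarith [hyt i]) (by linarith [hy T₀ hT₀.1])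
    set z : ι → ℚ := fun j => y j + if j = i then δ else 0 with hz
    have hyz : ∀ j, y j ≤ z j := fun j => by
      simp only [hz]; split_ifs <;> linarith
    have hsum : ∀ T : Finset ι, ∑ j ∈ T, z j = ∑ j ∈ T, y j + if i ∈ T then δ else 0 := by
      intro T; simp [hz, sum_add_distrib, sum_ite_eq']
    have hzP : ∀ T ⊆ S, ∑ j ∈ T, z j ≤ ρ T := by
      intro T hT
      rw [hsum]
      split_ifs with h
      · linarith [hmin T ⟨hT, h⟩, min_le_right (t - y i) ((ρ T₀ : ℚ) - ∑ j ∈ T₀, y j)]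
      · linarith [hy T hT]
    have hzt : ∀ j, z j ≤ t := by
      intro j
      simp only [hz]
      split_ifs with h
      · subst h; linarith [min_le_left (t - y j) ((ρ T₀ : ℚ) - ∑ j ∈ T₀, y j)]
      · linarith [hyt j]
    refine ⟨z, fun j => (hxy j).trans (hyz j), hzt, hzP, ?_⟩
    intro j hj
    rcases mem_insert.1 hj with rfl | hj
    · rcases min_choice (t - y j) ((ρ T₀ : ℚ) - ∑ j ∈ T₀, y j) with h | h
      · left; simp [hz, hδ, h]
      · right
        refine ⟨T₀, hT₀.1, hT₀.2, ?_⟩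
        rw [hsum, if_pos hT₀.2, hδ, h]; ring
    · rcases hsat j hj with h | ⟨T, hT, hjT, h⟩
      · left; exact le_antisymm (hzt j) (h ▸ hyz j)
      · right
        exact ⟨T, hT, hjT, le_antisymm (hzP T hT) (h ▸ sum_le_sum fun j _ => hyz j)⟩

/-- If `ρ T - t |T|` is minimal among the subsets `T` of `S` at `T = S`, then `S` carries a
positive weight `y ≤ t` of total mass `ρ S` with `y(T) ≤ ρ T` for all `T ⊆ S`. -/
theorem exists_tight_weight (hρ : IsRankFunction ρ) (h1 : ∀ i, ρ {i} = 1) (S : Finset ι) {t : ℚ}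
    (ht : 0 < t) (hS : ∀ T ⊆ S, (ρ S : ℚ) - t * #S ≤ ρ T - t * #T) :
    ∃ y : ι → ℚ, (∀ i, 0 < y i) ∧ (∀ i, y i ≤ t) ∧ (∀ T ⊆ S, ∑ i ∈ T, y i ≤ ρ T) ∧
      ∑ i ∈ S, y i = ρ S := by
  obtain ⟨y, hxy, hyt, hy, hsat⟩ := exists_saturated (ρ := ρ) S t (fun _ => min t (1 / (#S + 1)))
    (fun _ => min_le_left _ _) (fun T hT => by
      rcases T.eq_empty_or_nonempty with rfl | ⟨i, hi⟩
      · simp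
      have e1 : (1 : ℚ) ≤ ρ T := by
        exact_mod_cast (h1 i).symm.le.trans (hρ.mono (singleton_subset_iff.2 hi))
      have e2 : (#T : ℚ) ≤ #S := by exact_mod_cast card_le_card hT
      have e3 : (#T : ℚ) * min t (1 / (#S + 1)) ≤ #T * (1 / (#S + 1)) :=
        mul_le_mul_of_nonneg_left (min_le_right _ _) (by positivity)
      have e4 : (#T : ℚ) * (1 / (#S + 1)) ≤ 1 := by
        rw [mul_one_div, div_le_one (by positivity)]; linarith
      rw [sum_const, nsmul_eq_mul]; linarith) S Subset.rfl
  refine ⟨y, fun i => lt_of_lt_of_le (lt_min ht (by positivity)) (hxy i), hyt, hy, ?_⟩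
  -- By submodularity a union of tight sets is tight. So a tight set `T` of maximal size contains
  -- all of them, and every coordinate in `S \ T` is blocked by `t`. Hence `y(S) = ρ T + t (#S - #T)
  -- ≥ ρ S`.
  obtain ⟨T, hT, hmax⟩ := ({T ∈ S.powerset | ∑ i ∈ T, y i = ρ T}).exists_max_image
    (fun T => #T) ⟨∅, by simp [hρ.empty]⟩
  simp only [mem_filter, mem_powerset] at hT hmax
  have hout : ∀ i ∈ S \ T, y i = t := by
    intro i hi
    rw [mem_sdiff] at hi
    rcases hsat i hi.1 with h | ⟨T', hT', hiT', h⟩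
    · exact h
    exfalso
    have hsub : (ρ (T ∪ T') : ℚ) + ρ (T ∩ T') ≤ ρ T + ρ T' := by exact_mod_cast hρ.submod T T'
    have e1 := sum_union_inter (s₁ := T) (s₂ := T') (f := y)
    have e2 := hy (T ∪ T') (union_subset hT.1 hT')
    have e3 := hy (T ∩ T') (inter_subset_left.trans hT.1)
    have e4 := hmax (T ∪ T') ⟨union_subset hT.1 hT', by linarith [hT.2]⟩
    have e5 : T ⊂ T ∪ T' := (ssubset_iff_of_subset subset_union_left).2
      ⟨i, mem_union_right _ hiT', hi.2⟩
    have := card_lt_card e5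
    omega
  have e1 := sum_sdiff hT.1 (f := y)
  have e2 : (#(S \ T) : ℚ) = #S - #T := cast_card_sdiff hT.1
  rw [sum_congr rfl hout, sum_const, nsmul_eq_mul, hT.2, e2] at e1
  have e3 := hS T hT.1
  have e4 := hy S Subset.rfl
  linarith

/-! ### Nochka weights of a matroid -/

variable [Fintype ι]

/-- In rank `k` a set has at most `N` elements, since otherwise it would contain a spanning `(N +
1)`-set. In lower rank, adjoin an element that raises the rank: size and rank both grow by one. -/
theorem card_add_le_of_rank_le (hρ : IsRankFunction ρ) {k N : ℕ}
    (hcard : N + 1 ≤ Fintype.card ι) (hN : ∀ R, #R = N + 1 → ρ R = k + 1) (R : Finset ι)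
    (hR : ρ R ≤ k) : #R + k ≤ N + ρ R := by
  obtain ⟨m, hm⟩ := Nat.exists_eq_add_of_le hR
  induction m generalizing R with
  | zero =>
    by_contra hlt
    obtain ⟨R', hR', hc⟩ := exists_subset_card_eq (show N + 1 ≤ #R by omega)
    have := hρ.mono hR'
    have := hN R' hc
    omega
  | succ m ih =>
    obtain ⟨i, hi⟩ : ∃ i, ρ R < ρ (insert i R) := by
      by_contra! h
      have h1 := hρ.union_le_of_insert_le h univ
      obtain ⟨R', hR', hc⟩ := exists_subset_card_eq (s := (univ : Finset ι)) (n := N + 1)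
        (by simpa using hcard)
      have h2 := hN R' hc
      have h3 := hρ.mono (hR'.trans (subset_union_right : univ ⊆ R ∪ univ))
      omega
    have h1 := hρ.insert_le i R
    have hiR : i ∉ R := fun h => by rw [insert_eq_of_mem h] at hi; omega
    have h2 := ih (insert i R) (by omega) (by omega)
    rw [card_insert_of_notMem hiR] at h2
    omega

/-- **Nochka weights** for a matroid without loops of rank `k + 1` in which all sets of
`N + 1` elements are spanning. -/
theorem exists_nochka_weights (hρ : IsRankFunction ρ) {k N : ℕ} (hk : 1 ≤ k) (hkN : k ≤ N)
    (h1 : ∀ i, ρ {i} = 1)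
    (hq : 2 * N + 1 < Fintype.card ι + k) (hN : ∀ R, #R = N + 1 → ρ R = k + 1) :
    ∃ (ω : ι → ℚ) (t : ℚ), (∀ i, 0 < ω i) ∧ IsGreatest (Set.range ω) t ∧
      ∑ i, ω i = t * ((Fintype.card ι : ℚ) - 2 * N + k - 1) + k + 1 ∧
      ((k : ℚ) + 1) / (2 * N - k + 1) ≤ t ∧ t ≤ (k : ℚ) / N ∧
      ∀ R : Finset ι, #R ≤ N + 1 → ∑ i ∈ R, ω i ≤ ρ R := by
  have hcard : N + 1 ≤ Fintype.card ι := by omega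
  have hflat := hρ.card_add_le_of_rank_le hcard hN
  have hflatQ : ∀ R, ρ R ≤ k → (#R : ℚ) + k ≤ N + ρ R := fun R hR => by exact_mod_cast hflat R hR
  have hkNQ : (k : ℚ) ≤ N := by exact_mod_cast hkN
  have hkQ : (1 : ℚ) ≤ k := by exact_mod_cast hk
  obtain ⟨S, hSk, hmax⟩ := ({S : Finset ι | ρ S ≤ k} : Finset (Finset ι)).exists_max_image
    (fun S => ((k : ℚ) + 1 - ρ S) / (2 * N - k + 1 - #S)) ⟨∅, by simp [hρ.empty]⟩
  simp only [mem_filter, mem_univ, true_and] at hSk hmax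
  set t : ℚ := ((k : ℚ) + 1 - ρ S) / (2 * N - k + 1 - #S) with ht_def
  have hrk : ∀ R, ρ R ≤ k → (ρ R : ℚ) ≤ k := fun R h => by exact_mod_cast h
  have hden : ∀ R, ρ R ≤ k → (0 : ℚ) < 2 * N - k + 1 - #R := fun R h => by
    linarith [hflatQ R h, hrk R h]
  have htS : t * (2 * N - k + 1 - #S) = k + 1 - ρ S := div_mul_cancel₀ _ (hden S hSk).ne'
  have htR : ∀ R, ρ R ≤ k → (k : ℚ) + 1 - ρ R ≤ t * (2 * N - k + 1 - #R) := fun R h =>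
    (div_le_iff₀ (hden R h)).1 (hmax R h)
  have ht0 : 0 < t := div_pos (by linarith [hrk S hSk]) (hden S hSk)
  obtain ⟨y, hy0, hyt, hy, hyS⟩ := hρ.exists_tight_weight h1 S ht0 fun T hT => by
    have := htR T ((hρ.mono hT).trans hSk)
    linarith
  -- As `k ≤ N`, this forces `t ≤ 1`; for nonempty `S` it then gives `t ≤ k / N`.
  have htb : t * ((N : ℚ) + 1 - ρ S) ≤ k + 1 - ρ S := by
    rw [← htS]
    exact mul_le_mul_of_nonneg_left (by linarith [hflatQ S hSk]) ht0.le
  have hSN : #S ≤ N := by have := hflat S hSk; omega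
  set ω : ι → ℚ := fun i => if i ∈ S then y i else t with hω
  have hωsum : ∀ R : Finset ι, ∑ i ∈ R, ω i = ∑ i ∈ R ∩ S, y i + t * #(R \ S) := by
    intro R
    rw [← sum_inter_add_sum_sdiff R S]
    congr 1
    · exact sum_congr rfl fun i hi => by simp [hω, (mem_inter.1 hi).2]
    · rw [sum_congr rfl (g := fun _ => t) fun i hi => by simp [hω, (mem_sdiff.1 hi).2], sum_const,
        nsmul_eq_mul, mul_comm]
  refine ⟨ω, t, ?_, ⟨?_, ?_⟩, ?_, ?_, ?_, ?_⟩
  · intro i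
    simp only [hω]
    split_ifs
    exacts [hy0 i, ht0]
  · obtain ⟨i, hi⟩ : ∃ i, i ∉ S := by
      by_contra! h
      rw [eq_univ_of_forall h, card_univ] at hSN
      omega
    exact ⟨i, by simp [hω, hi]⟩
  · rintro _ ⟨i, rfl⟩
    simp only [hω]
    split_ifs
    exacts [hyt i, le_rfl]
  · rw [hωsum, univ_inter, hyS, cast_card_sdiff (subset_univ S), card_univ]
    linarith
  · simpa [hρ.empty] using hmax ∅ (by simp [hρ.empty])
  · rw [le_div_iff₀ (by linarith)]
    rcases S.eq_empty_or_nonempty with rfl | ⟨i, hi⟩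
    · simp only [hρ.empty, card_empty, Nat.cast_zero, sub_zero] at htS
      have hd : (0 : ℚ) < 2 * N - k + 1 := by linarith
      by_contra! hlt
      -- Here `t = (k + 1) / (2N - k + 1)`, and `t ≤ k / N` amounts to `(N - k)(k - 1) ≥ 0`.
      nlinarith [mul_nonneg (sub_nonneg.2 hkNQ) (sub_nonneg.2 hkQ)]
    · have hr : (1 : ℚ) ≤ ρ S := by
        exact_mod_cast (h1 i).symm.le.trans (hρ.mono (singleton_subset_iff.2 hi))
      have ht1 : t ≤ 1 := by
        by_contra! hlt
        nlinarith [hrk S hSk]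
      nlinarith
  · intro R hR
    rw [hωsum]
    have e1 := hy (R ∩ S) inter_subset_right
    have hsub : (ρ (R ∪ S) : ℚ) + ρ (R ∩ S) ≤ ρ R + ρ S := by exact_mod_cast hρ.submod R S
    have e2 : (#(R \ S) : ℚ) + #(R ∩ S) = #R := by exact_mod_cast card_sdiff_add_card_inter R S
    -- If `R ∪ S` spans, put `m = ρ R - ρ (R ∩ S) ≥ k + 1 - ρ S`. Then `#(R \ S) ≤ N - k + m`, and
    -- `t (N - k + m) ≤ m` follows from `htb` and `t ≤ 1`. Otherwise `R ∪ S` competes with `S` for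
    -- the slope, so `t #(R \ S) ≤ ρ (R ∪ S) - ρ S`.
    rcases Nat.lt_or_ge k (ρ (R ∪ S)) with h | h
    · have e3 : (#R : ℚ) + k ≤ N + ρ R := by
        rcases Nat.lt_or_ge k (ρ R) with h' | h'
        · exact_mod_cast (by omega : #R + k ≤ N + ρ R)
        · exact hflatQ R h'
      have e4 : (ρ (R ∩ S) : ℚ) ≤ #(R ∩ S) := by exact_mod_cast hρ.le_card _
      have e5 : (k : ℚ) + 1 ≤ ρ (R ∪ S) := by exact_mod_cast h
      have e6 : t * #(R \ S) ≤ t * (N - k + (ρ R - ρ (R ∩ S))) :=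
        mul_le_mul_of_nonneg_left (by linarith) ht0.le
      have ht1 : t ≤ 1 := by
        by_contra! hlt
        nlinarith [hrk S hSk]
      nlinarith
    · have e3 := htR _ h
      have e4 : (#(R ∪ S) : ℚ) = #(R \ S) + #S := by
        rw [← sdiff_union_self_eq_union, card_union_of_disjoint sdiff_disjoint, Nat.cast_add]
      rw [e4] at e3
      linarith

end IsRankFunction

end NochkaWeights

/-! ### Projective algebraic sets and their vanishing ideals -/

namespace NochkaWeights

open MvPolynomial

variable {n : ℕ}

theorem eval_smul_of_isHomogeneous {σ R : Type*} [CommSemiring R] {f : MvPolynomial σ R} {d : ℕ}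
    (hf : f.IsHomogeneous d) (t : R) (v : σ → R) : eval (t • v) f = t ^ d * eval v f := by
  rw [eval_eq, eval_eq, Finset.mul_sum]
  refine Finset.sum_congr rfl fun m hm => ?_
  have hm' : m.degree = d := by
    rw [Finsupp.degree_eq_weight_one]
    exact hf (mem_support_iff.1 hm)
  simp only [Pi.smul_apply, smul_eq_mul, mul_pow, Finset.prod_mul_distrib]
  rw [Finset.prod_pow_eq_pow_sum, ← hm', Finsupp.degree_apply]
  ring

/-- The polynomial `t ↦ f (t v)`. -/
noncomputable def restrictLine (v : Fin (n + 1) → ℂ) :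
    MvPolynomial (Fin (n + 1)) ℂ →ₐ[ℂ] Polynomial ℂ :=
  aeval fun i => Polynomial.C (v i) * Polynomial.X

theorem eval_restrictLine (v : Fin (n + 1) → ℂ) (f : MvPolynomial (Fin (n + 1)) ℂ) (t : ℂ) :
    (restrictLine v f).eval t = eval (t • v) f := by
  have h : (Polynomial.aeval t).comp (restrictLine v) = aeval (t • v) := by
    ext i
    simpa [restrictLine] using mul_comm _ _
  simpa [aeval_eq_eval] using DFunLike.congr_fun h f

theorem restrictLine_of_isHomogeneous {f : MvPolynomial (Fin (n + 1)) ℂ} {d : ℕ}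
    (hf : f.IsHomogeneous d) (v : Fin (n + 1) → ℂ) :
    restrictLine v f = Polynomial.C (eval v f) * Polynomial.X ^ d :=
  Polynomial.funext fun t => by
    rw [eval_restrictLine, eval_smul_of_isHomogeneous hf, mul_comm]; simp

/-- The representatives of a point are the `t • v` with `t ≠ 0`, and a polynomial in `t` vanishing
at all of them is zero. Vanishing of an inhomogeneous `f` thus becomes an identity in the domain
`ℂ[t]`. -/
theorem vanishesAt_mk_iff (f : MvPolynomial (Fin (n + 1)) ℂ) (v : Fin (n + 1) → ℂ) (hv : v ≠ 0) :
    VanishesAt f (Projectivization.mk ℂ v hv) ↔ restrictLine v f = 0 := by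
  constructor
  · intro h
    have h0 : restrictLine v f * Polynomial.X = 0 := Polynomial.funext fun t => by
      rcases eq_or_ne t 0 with rfl | ht
      · simp
      · have htv : t • v ≠ 0 := smul_ne_zero ht hv
        have := h (t • v) htv ((Projectivization.mk_eq_mk_iff' ℂ _ _ htv hv).2 ⟨t, rfl⟩)
        simp [eval_restrictLine, this]
    exact (mul_eq_zero.1 h0).resolve_right Polynomial.X_ne_zero
  · intro h w hw hwv
    obtain ⟨a, rfl⟩ := (Projectivization.mk_eq_mk_iff' ℂ _ _ hw hv).1 hwv
    rw [← eval_restrictLine, h, Polynomial.eval_zero]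

theorem vanishesAt_mk_iff_of_isHomogeneous {f : MvPolynomial (Fin (n + 1)) ℂ} {d : ℕ}
    (hf : f.IsHomogeneous d) (v : Fin (n + 1) → ℂ) (hv : v ≠ 0) :
    VanishesAt f (Projectivization.mk ℂ v hv) ↔ eval v f = 0 := by
  rw [vanishesAt_mk_iff, restrictLine_of_isHomogeneous hf]
  simp

theorem exists_rep (p : ProjSpace n) : ∃ (v : Fin (n + 1) → ℂ) (hv : v ≠ 0),
    p = Projectivization.mk ℂ v hv :=
  ⟨Projectivization.rep p, Projectivization.rep_nonzero p, (Projectivization.mk_rep p).symm⟩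

theorem vanishesAt_mul (f g : MvPolynomial (Fin (n + 1)) ℂ) (p : ProjSpace n) :
    VanishesAt (f * g) p ↔ VanishesAt f p ∨ VanishesAt g p := by
  obtain ⟨v, hv, rfl⟩ := exists_rep p
  simp only [vanishesAt_mk_iff, map_mul, mul_eq_zero]

theorem not_vanishesAt_one (p : ProjSpace n) :
    ¬ VanishesAt (1 : MvPolynomial (Fin (n + 1)) ℂ) p := by
  obtain ⟨v, hv, rfl⟩ := exists_rep p
  simp [vanishesAt_mk_iff]

theorem vanishesAt_iff_homogeneousComponent (f : MvPolynomial (Fin (n + 1)) ℂ) (p : ProjSpace n) :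
    VanishesAt f p ↔ ∀ d, VanishesAt (homogeneousComponent d f) p := by
  obtain ⟨v, hv, rfl⟩ := exists_rep p
  have hsum : restrictLine v f = ∑ d ∈ Finset.range (f.totalDegree + 1),
      restrictLine v (homogeneousComponent d f) := by
    rw [← map_sum, sum_homogeneousComponent]
  simp only [vanishesAt_mk_iff]
  constructor
  · intro h d
    rcases Nat.lt_or_ge f.totalDegree d with hd | hd
    · rw [homogeneousComponent_eq_zero _ _ hd, map_zero]
    have hc := congrArg (fun P => Polynomial.coeff P d) (hsum.symm.trans h)
    simp only [Polynomial.finsetSum_coeff, Polynomial.coeff_zero,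
      restrictLine_of_isHomogeneous (homogeneousComponent_isHomogeneous _ f),
      Polynomial.coeff_C_mul_X_pow] at hc
    rw [Finset.sum_ite_eq, if_pos (Finset.mem_range.2 (Nat.lt_succ_of_le hd))] at hc
    rw [restrictLine_of_isHomogeneous (homogeneousComponent_isHomogeneous _ f), hc]
    simp
  · intro h
    rw [hsum]
    exact Finset.sum_eq_zero fun d _ => h d

theorem isClosed_hypersurface (f : MvPolynomial (Fin (n + 1)) ℂ) : IsClosed (hypersurface f) := by
  have h : hypersurface f = ⋂ d, hypersurface (homogeneousComponent d f) := by
    ext p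
    simp only [hypersurface, Set.mem_iInter]
    exact vanishesAt_iff_homogeneousComponent f p
  rw [h]
  refine isClosed_iInter fun d => ⟨?_⟩
  exact TopologicalSpace.isOpen_generateFrom_of_mem
    ⟨d, _, homogeneousComponent_isHomogeneous d f, rfl⟩

/-- A point outside a closed set is separated from it by a form. -/
theorem exists_form_of_notMem {W : Set (ProjSpace n)} (hW : IsClosed W) {p : ProjSpace n}
    (hp : p ∉ W) : ∃ (d : ℕ) (f : MvPolynomial (Fin (n + 1)) ℂ), f.IsHomogeneous d ∧
      f ∈ vanishingIdeal W ∧ ¬ VanishesAt f p := by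
  suffices h : ∀ U : Set (ProjSpace n), IsOpen U → ∀ p ∈ U,
      ∃ (d : ℕ) (f : MvPolynomial (Fin (n + 1)) ℂ), f.IsHomogeneous d ∧
        (∀ x ∉ U, VanishesAt f x) ∧ ¬ VanishesAt f p by
    obtain ⟨d, f, hf, hfW, hfp⟩ := h Wᶜ hW.isOpen_compl p hp
    exact ⟨d, f, hf, fun x hx => hfW x (by simpa using hx), hfp⟩
  -- Induction on the generation of the topology; an intersection of open sets corresponds to a
  -- product of forms.
  intro U hU
  change TopologicalSpace.GenerateOpen _ U at hU
  induction hU with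
  | basic U h =>
    obtain ⟨d, f, hf, rfl⟩ := h
    exact fun p hp => ⟨d, f, hf, fun x hx => by simpa [hypersurface] using hx, hp⟩
  | univ => exact fun p _ => ⟨0, 1, isHomogeneous_one _ _, by simp, not_vanishesAt_one p⟩
  | inter U₁ U₂ _ _ ih₁ ih₂ =>
    intro p hp
    obtain ⟨d₁, f₁, hf₁, h₁, hp₁⟩ := ih₁ p hp.1
    obtain ⟨d₂, f₂, hf₂, h₂, hp₂⟩ := ih₂ p hp.2
    refine ⟨d₁ + d₂, f₁ * f₂, hf₁.mul hf₂, fun x hx => ?_, ?_⟩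
    · rw [vanishesAt_mul]
      by_cases hx₁ : x ∈ U₁
      · exact Or.inr (h₂ x fun hx₂ => hx ⟨hx₁, hx₂⟩)
      · exact Or.inl (h₁ x hx₁)
    · rw [vanishesAt_mul, not_or]
      exact ⟨hp₁, hp₂⟩
  | sUnion 𝒰 _ ih =>
    rintro p ⟨U, hU, hp⟩
    obtain ⟨d, f, hf, h, hfp⟩ := ih U hU p hp
    exact ⟨d, f, hf, fun x hx => h x fun hxU => hx ⟨U, hU, hxU⟩, hfp⟩

theorem vanishingIdeal_isPrime {W : Set (ProjSpace n)} (hW : IsIrreducible W) :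
    (vanishingIdeal W).IsPrime := by
  refine ⟨?_, fun {f g} hfg => ?_⟩
  · obtain ⟨p, hp⟩ := hW.nonempty
    rw [Ideal.ne_top_iff_one]
    exact fun h => not_vanishesAt_one p (h p hp)
  · exact isPreirreducible_iff_isClosed_union_isClosed.1 hW.isPreirreducible
      (hypersurface f) (hypersurface g) (isClosed_hypersurface f) (isClosed_hypersurface g)
      fun p hp => (vanishesAt_mul f g p).1 (hfg p hp)

theorem vanishingIdeal_lt {W W' : Set (ProjSpace n)} (hW : IsClosed W) (h : W ⊂ W') :
    vanishingIdeal W' < vanishingIdeal W := by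
  refine lt_of_le_of_ne (fun f hf p hp => hf p (h.1 hp)) fun he => ?_
  obtain ⟨p, hp', hp⟩ := Set.exists_of_ssubset h
  obtain ⟨d, f, -, hf, hfp⟩ := exists_form_of_notMem hW hp
  rw [← he] at hf
  exact hfp (hf p hp')

theorem vanishingIdeal_lt_vanishingIdeal_zero {W : Set (ProjSpace n)} (hW : W.Nonempty) :
    vanishingIdeal W < MvPolynomial.vanishingIdeal ℂ {(0 : Fin (n + 1) → ℂ)} := by
  obtain ⟨p, hp⟩ := hW
  obtain ⟨v, hv, rfl⟩ := exists_rep p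
  refine lt_of_le_of_ne (fun f hf => ?_) fun he => hv ?_
  · rw [mem_vanishingIdeal_singleton_iff, aeval_eq_eval]
    have := (vanishesAt_mk_iff f v hv).1 (hf _ hp)
    have h0 := eval_restrictLine v f 0
    rw [this, zero_smul] at h0
    simpa using h0.symm
  · ext i
    have hX : (X i : MvPolynomial (Fin (n + 1)) ℂ) ∈ vanishingIdeal W := by
      rw [he, mem_vanishingIdeal_singleton_iff]; simp
    simpa using hX _ hp v hv rfl

/-! ### Dimension and common zeros -/

/-- Krull's height theorem, relative to a prime at the bottom of a chain. -/
theorem chain_length_le_card {R : Type*} [CommRing R] [IsNoetherianRing R]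
    (s : LTSeries (PrimeSpectrum R)) (T : Finset R)
    (hT : s.last.asIdeal ∈ (s.head.asIdeal ⊔ Ideal.span T).minimalPrimes) :
    s.length ≤ T.card := by
  classical
  set P := s.head.asIdeal
  let e := P.primeSpectrumQuotientOrderIsoZeroLocus
  let s' : LTSeries (PrimeSpectrum (R ⧸ P)) := LTSeries.mk s.length
    (fun i => e.symm ⟨s i, s.head_le i⟩)
    (fun i j hij => e.symm.strictMono (s.strictMono hij))
  have hcomap : ∀ x : PrimeSpectrum.zeroLocus (P : Set R),
      (e.symm x).asIdeal.comap (Ideal.Quotient.mk P) = x.1.asIdeal := fun x => by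
    conv_rhs => rw [← e.apply_symm_apply x]
    rfl
  have hlast : s'.last.asIdeal.comap (Ideal.Quotient.mk P) = s.last.asIdeal := hcomap _
  have hmin : s'.last.asIdeal ∈
      (Ideal.span (T.image (Ideal.Quotient.mk P) : Set (R ⧸ P))).minimalPrimes := by
    rw [Finset.coe_image, ← Ideal.map_span]
    refine ⟨⟨s'.last.isPrime, ?_⟩, fun J hJ hle => ?_⟩
    · rw [Ideal.map_le_iff_le_comap, hlast]
      exact le_sup_right.trans hT.1.2
    · have hJ' := hJ.1.comap (Ideal.Quotient.mk P)
      have h1 : P ⊔ Ideal.span T ≤ J.comap (Ideal.Quotient.mk P) :=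
        sup_le (fun x hx => by
          rw [Ideal.mem_comap, Ideal.Quotient.eq_zero_iff_mem.2 hx]; exact J.zero_mem)
          (Ideal.map_le_iff_le_comap.1 hJ.2)
      have h2 := hT.2 ⟨hJ', h1⟩ (by rw [← hlast]; exact Ideal.comap_mono hle)
      rw [← hlast] at h2
      exact (Ideal.comap_le_comap_iff_of_surjective _ Ideal.Quotient.mk_surjective _ _).1 h2
  have h1 := Ideal.height_le_card_of_mem_minimalPrimes_span_finset hmin
  rw [PrimeSpectrum.height_eq_orderHeight] at h1
  have h2 : (s.length : ℕ∞) ≤ Order.height s'.last := Order.length_le_height_last (p := s')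
  have h3 := h2.trans h1
  exact (by exact_mod_cast h3 : s.length ≤ _).trans Finset.card_image_le

/-- At most `dim V` hypersurfaces have a common point on a projective algebraic set `V`. -/
theorem exists_common_zero {k d : ℕ} {V : Set (ProjSpace n)} (hV : IsClosed V)
    (hdim : (k : WithBot ℕ∞) ≤ topologicalKrullDim V) (T : Finset (MvPolynomial (Fin (n + 1)) ℂ))
    (hT : ∀ f ∈ T, f.IsHomogeneous d) (hd : d ≠ 0) (hTk : T.card ≤ k) :
    ∃ p ∈ V, ∀ f ∈ T, VanishesAt f p := by
  by_contra! hno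
  obtain ⟨l, hl⟩ := Order.le_krullDim_iff.1 hdim
  let ι := TopologicalSpace.IrreducibleCloseds.map (Subtype.val : V → ProjSpace n)
    continuous_subtype_val
  have hι : StrictMono ι :=
    TopologicalSpace.IrreducibleCloseds.map_strictMono_of_isInducing Topology.IsInducing.subtypeVal
  have hιV : ∀ Y, (ι Y : Set (ProjSpace n)) ⊆ V := fun Y =>
    closure_minimal (by rintro _ ⟨x, -, rfl⟩; exact x.2) hV
  let J : TopologicalSpace.IrreducibleCloseds V → PrimeSpectrum (MvPolynomial (Fin (n + 1)) ℂ) :=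
    fun Y => ⟨vanishingIdeal (ι Y : Set (ProjSpace n)), vanishingIdeal_isPrime (ι Y).isIrreducible⟩
  have hJ : StrictAnti J := fun Y Y' h => vanishingIdeal_lt (ι Y).isClosed (hι h)
  -- A chain of `k + 1` irreducible closed sets, reversed, gives a chain of primes starting at
  -- `I(W)` for the largest set `W`; the ideal `𝔪` of the origin lengthens it by one. Without common
  -- zeros, the Nullstellensatz makes `𝔪` minimal over `I(W) + (T)`, so `k + 1 ≤ #T`.
  let c : LTSeries (PrimeSpectrum (MvPolynomial (Fin (n + 1)) ℂ)) :=
    LTSeries.mk l.length (fun i => J (l i.rev))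
      (fun i j hij => hJ (l.strictMono (Fin.rev_lt_rev.2 hij)))
  let 𝔪 : PrimeSpectrum (MvPolynomial (Fin (n + 1)) ℂ) :=
    ⟨MvPolynomial.vanishingIdeal ℂ {(0 : Fin (n + 1) → ℂ)}, inferInstance⟩
  have hc𝔪 : c.last < 𝔪 := vanishingIdeal_lt_vanishingIdeal_zero (ι _).isIrreducible.nonempty
  let s := c.snoc 𝔪 hc𝔪
  have hhead : s.head = J (l (Fin.last _)) := by
    rw [RelSeries.head_snoc]
    change J (l (Fin.rev 0)) = _
    rw [Fin.rev_zero]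
  have hlast : s.last = 𝔪 := RelSeries.last_snoc _ _ _
  let W : Set (ProjSpace n) := ι (l (Fin.last _))
  have hWV : W ⊆ V := hιV _
  have hWc : IsClosed W := (ι _).isClosed
  have hheadI : s.head.asIdeal = vanishingIdeal W := by rw [hhead]
  have hzero : zeroLocus ℂ (vanishingIdeal W ⊔ Ideal.span (T : Set (MvPolynomial (Fin (n + 1)) ℂ)))
      ⊆ {(0 : Fin (n + 1) → ℂ)} := by
    intro v hv
    by_contra hv0
    have hv0 : v ≠ 0 := hv0
    have hvW : (Projectivization.mk ℂ v hv0 : ProjSpace n) ∈ W := by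
      by_contra hnot
      obtain ⟨e, f, hf, hfW, hfp⟩ := exists_form_of_notMem hWc hnot
      rw [vanishesAt_mk_iff_of_isHomogeneous hf] at hfp
      have hfv := hv f (Ideal.mem_sup_left hfW)
      rw [aeval_eq_eval] at hfv
      exact hfp hfv
    obtain ⟨f, hfT, hf⟩ := hno _ (hWV hvW)
    rw [vanishesAt_mk_iff_of_isHomogeneous (hT f hfT)] at hf
    have hfv := hv f (Ideal.mem_sup_right (Ideal.subset_span hfT))
    rw [aeval_eq_eval] at hfv
    exact hf hfv
  have hmin : s.last.asIdeal ∈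
      (s.head.asIdeal ⊔ Ideal.span (T : Set (MvPolynomial (Fin (n + 1)) ℂ))).minimalPrimes := by
    rw [hlast, hheadI]
    refine ⟨⟨𝔪.isPrime, sup_le ?_ (Ideal.span_le.2 fun f hf => ?_)⟩, fun I hI _ => ?_⟩
    · exact (vanishingIdeal_lt_vanishingIdeal_zero (ι _).isIrreducible.nonempty).le
    · change f ∈ MvPolynomial.vanishingIdeal ℂ {(0 : Fin (n + 1) → ℂ)}
      rw [mem_vanishingIdeal_singleton_iff, aeval_eq_eval]
      -- Positive degree makes `f` vanish at the origin.
      have := eval_smul_of_isHomogeneous (hT f hf) 0 0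
      simpa [hd] using this
    · have h1 := MvPolynomial.vanishingIdeal_anti_mono (k := ℂ) hzero
      rw [vanishingIdeal_zeroLocus_eq_radical] at h1
      exact h1.trans ((hI.1.radical_le_iff).2 hI.2)
  have := chain_length_le_card s T hmin
  have hs : s.length = l.length + 1 := rfl
  omega

end NochkaWeights

/-! ### Ranks of hypersurfaces on `V` -/

namespace NochkaWeights

variable {n d q : ℕ}

theorem isRankFunction_finrank_span {K M ι : Type*} [Field K] [AddCommGroup M] [Module K M]
    [DecidableEq ι] (v : ι → M) :
    IsRankFunction fun R : Finset ι => Module.finrank K (Submodule.span K (v '' (R : Set ι))) := by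
  have hfin : ∀ R : Finset ι, FiniteDimensional K (Submodule.span K (v '' (R : Set ι))) :=
    fun R => FiniteDimensional.span_of_finite K (R.finite_toSet.image v)
  have hmono : ∀ {S T : Finset ι}, S ⊆ T →
      Submodule.span K (v '' (S : Set ι)) ≤ Submodule.span K (v '' (T : Set ι)) :=
    fun h => Submodule.span_mono (Set.image_mono (Finset.coe_subset.2 h))
  refine ⟨by simp, fun h => Submodule.finrank_mono (hmono h), fun i S => ?_, fun S T => ?_⟩
  · rw [Finset.coe_insert, Set.image_insert_eq, Set.insert_eq, Submodule.span_union, add_comm]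
    refine (Submodule.finrank_add_le_finrank_add_finrank _ _).trans ?_
    gcongr
    simpa using finrank_span_le_card (R := K) ({v i} : Set M)
  · have h := Submodule.finrank_sup_add_finrank_inf_eq
      (Submodule.span K (v '' (S : Set ι))) (Submodule.span K (v '' (T : Set ι)))
    rw [← h, Finset.coe_union, Set.image_union, Submodule.span_union]
    gcongr
    exact Submodule.finrank_mono
      (le_inf (hmono Finset.inter_subset_left) (hmono Finset.inter_subset_right))

theorem isRankFunction_rankOn (V : Set (ProjSpace n)) (Q : Fin q → Forms n d) :
    IsRankFunction (rankOn V Q) :=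
  isRankFunction_finrank_span (K := ℂ) fun i => (Submodule.Quotient.mk (Q i) : FormsOn V d)

/-- The forms of degree `d` whose classes lie in the span of the classes of `Q i`, `i ∈ R`, vanish
at the common zeros of these `Q i` on `V`. -/
theorem vanishesAt_of_mem_span {V : Set (ProjSpace n)} {Q : Fin q → Forms n d}
    {R : Finset (Fin q)} {p : ProjSpace n} (hpV : p ∈ V)
    (hp : ∀ i ∈ R, VanishesAt (Q i : MvPolynomial (Fin (n + 1)) ℂ) p) {F : Forms n d}
    (hF : (Submodule.Quotient.mk F : FormsOn V d) ∈ Submodule.span ℂ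
      ((fun i => (Submodule.Quotient.mk (Q i) : FormsOn V d)) '' (R : Set (Fin q)))) :
    VanishesAt (F : MvPolynomial (Fin (n + 1)) ℂ) p := by
  have hle : vanishingForms V d ≤ vanishingForms {p} d := fun f hf x hx => by
    rw [Set.mem_singleton_iff.1 hx]; exact hf p hpV
  have hspan : Submodule.span ℂ
      ((fun i => (Submodule.Quotient.mk (Q i) : FormsOn V d)) '' (R : Set (Fin q))) ≤
      (vanishingForms {p} d).map (vanishingForms V d).mkQ := by
    rw [Submodule.span_le]
    rintro _ ⟨i, hi, rfl⟩
    exact ⟨Q i, fun x hx => by rw [Set.mem_singleton_iff.1 hx]; exact hp i hi, rfl⟩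
  obtain ⟨G, hG, hGF⟩ := hspan hF
  have hsub : G - F ∈ vanishingForms V d := (Submodule.Quotient.eq _).1 hGF
  have : F ∈ vanishingForms {p} d := by
    have := Submodule.sub_mem _ hG (hle hsub)
    rwa [sub_sub_cancel] at this
  exact this p rfl

theorem lt_rankOn_of_inter_eq_empty {k : ℕ} (hd : d ≠ 0) {V : Set (ProjSpace n)} (hV : IsClosed V)
    (hdim : (k : WithBot ℕ∞) ≤ topologicalKrullDim V) (Q : Fin q → Forms n d) (R : Finset (Fin q))
    (hR : V ∩ ⋂ i ∈ R, hypersurface (Q i : MvPolynomial (Fin (n + 1)) ℂ) = ∅) :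
    k < rankOn V Q R := by
  classical
  by_contra! hle
  -- Zero weights and values: only the existence of a basis is needed.
  obtain ⟨B, hBR, hB, hBc, -⟩ := (isRankFunction_rankOn V Q).exists_greedy_basis 0 0 R
    (fun T _ => by simp) 0 (fun _ _ => le_rfl)
  obtain ⟨p, hpV, hp⟩ := exists_common_zero hV hdim
    (B.image fun i => (Q i : MvPolynomial (Fin (n + 1)) ℂ))
    (fun f hf => by
      obtain ⟨i, -, rfl⟩ := Finset.mem_image.1 hf
      exact (MvPolynomial.mem_homogeneousSubmodule _ _).1 (Q i).2) hd
    (Finset.card_image_le.trans (hBc.trans_le hle))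
  have hspan : Submodule.span ℂ
      ((fun i => (Submodule.Quotient.mk (Q i) : FormsOn V d)) '' (B : Set (Fin q))) =
      Submodule.span ℂ
      ((fun i => (Submodule.Quotient.mk (Q i) : FormsOn V d)) '' (R : Set (Fin q))) := by
    have := FiniteDimensional.span_of_finite ℂ
      (R.finite_toSet.image fun i => (Submodule.Quotient.mk (Q i) : FormsOn V d))
    exact Submodule.eq_of_le_of_finrank_eq
      (Submodule.span_mono (Set.image_mono (Finset.coe_subset.2 hBR))) (hB.trans hBc)
  have hmem : p ∈ V ∩ ⋂ i ∈ R, hypersurface (Q i : MvPolynomial (Fin (n + 1)) ℂ) := by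
    refine ⟨hpV, Set.mem_iInter₂.2 fun i hi => ?_⟩
    refine vanishesAt_of_mem_span (R := B) hpV
      (fun j hj => hp _ (Finset.mem_image_of_mem _ hj)) ?_
    rw [hspan]
    exact Submodule.subset_span ⟨i, hi, rfl⟩
  rw [hR] at hmem
  exact hmem

theorem one_le_rankOn_singleton {V : Set (ProjSpace n)} {Q : Fin q → Forms n d} {i : Fin q}
    (hi : ¬ V ⊆ hypersurface (Q i : MvPolynomial (Fin (n + 1)) ℂ)) : 1 ≤ rankOn V Q {i} := by
  have hne : (Submodule.Quotient.mk (Q i) : FormsOn V d) ≠ 0 := fun h =>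
    hi fun p hp => (Submodule.Quotient.mk_eq_zero _).1 h p hp
  rw [rankOn, Finset.coe_singleton, Set.image_singleton, finrank_span_singleton hne]

end NochkaWeights

/-! ### The main theorem -/

theorem mainTheorem4 (n k N d q : ℕ) (hk : 1 ≤ k) (hd : 1 ≤ d)
    (V : Set (NochkaWeights.ProjSpace n)) (hV : IsClosed V)
    (hdim : topologicalKrullDim V = (k : WithBot ℕ∞))
    (Q : Fin q → NochkaWeights.Forms n d)
    (hQV : ∀ i, ¬ V ⊆ NochkaWeights.hypersurface (Q i : MvPolynomial (Fin (n + 1)) ℂ))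
    (hpos : NochkaWeights.InSubgeneralPosition N V Q)
    (hqk : k + 1 ≤ q) (hq : 2 * (N : ℤ) - k + 1 < q) :
    ∃ (ω : Fin q → ℚ) (ωt : ℚ),
      (∀ i, 0 < ω i ∧ ω i ≤ 1) ∧
      IsGreatest (Set.range ω) ωt ∧
      ∑ i, ω i = ωt * ((q : ℚ) - 2 * N + k - 1) + k + 1 ∧
      ((k : ℚ) + 1) / (2 * N - k + 1) ≤ ωt ∧
      ωt ≤ (k : ℚ) / N ∧
      (∀ R : Finset (Fin q), R.card = N + 1 → ∑ i ∈ R, ω i ≤ (k : ℚ) + 1) ∧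
      (∀ E : Fin q → ℝ, (∀ i, 1 ≤ E i) →
        ∀ R : Finset (Fin q), R.card = N + 1 →
          ∃ R' ⊆ R, R'.card = k + 1 ∧ NochkaWeights.rankOn V Q R' = k + 1 ∧
            ∏ i ∈ R, E i ^ (ω i : ℝ) ≤ ∏ i ∈ R', E i) := by
  have hrank := NochkaWeights.isRankFunction_rankOn V Q
  have hbig : ∀ R : Finset (Fin q), R.card = N + 1 → k < NochkaWeights.rankOn V Q R := fun R hR =>
    NochkaWeights.lt_rankOn_of_inter_eq_empty (by omega) hV hdim.ge Q R (hpos R hR)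
  have hkN : k ≤ N := by
    -- `q ≥ N + 1` needs both bounds on `q`: `hq` when `k ≤ N`, and `hqk` when `N < k`, a case not
    -- yet excluded.
    obtain ⟨R, -, hR⟩ := Finset.exists_subset_card_eq (s := (Finset.univ : Finset (Fin q)))
      (n := N + 1) (by rw [Finset.card_univ, Fintype.card_fin]; omega)
    have := hbig R hR
    have := hrank.le_card R
    omega
  -- The rank in `I_d(V)` may exceed `k + 1`. A basis for the truncated rank still consists of
  -- independent classes.
  have hρ := hrank.truncate (k + 1)
  have hN : ∀ R : Finset (Fin q), R.card = N + 1 →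
      min (NochkaWeights.rankOn V Q R) (k + 1) = k + 1 := fun R hR => min_eq_right (hbig R hR)
  obtain ⟨ω, t, hpos', hgr, hsum, hlow, hup, hR⟩ := hρ.exists_nochka_weights hk hkN
    (fun i => by
      have h1 := NochkaWeights.one_le_rankOn_singleton (hQV i)
      have h2 := hrank.le_card {i}
      rw [Finset.card_singleton] at h2
      omega) (by rw [Fintype.card_fin]; omega) hN
  rw [Fintype.card_fin] at hsum
  have ht1 : t ≤ 1 := hup.trans (div_le_one_of_le₀ (by exact_mod_cast hkN) (Nat.cast_nonneg N))
  refine ⟨ω, t, fun i => ⟨hpos' i, (hgr.2 ⟨i, rfl⟩).trans ht1⟩, hgr, hsum, hlow, hup, ?_, ?_⟩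
  · intro R hRc
    have := hR R hRc.le
    rw [hN R hRc] at this
    exact_mod_cast this
  · intro E hE R hRc
    have hE0 : ∀ i, 0 < E i := fun i => zero_lt_one.trans_le (hE i)
    obtain ⟨B, hBR, hB, hBc, hle⟩ := hρ.exists_greedy_basis (fun i => (ω i : ℝ))
      (fun i => Real.log (E i)) R
      (fun T hT => by exact_mod_cast hR T ((Finset.card_le_card hT).trans hRc.le)) 0
      (fun i _ => Real.log_nonneg (hE i))
    rw [hN R hRc] at hBc
    refine ⟨B, hBR, hBc, ?_, ?_⟩
    · have := hrank.le_card B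
      omega
    · rw [← Real.log_le_log_iff (Finset.prod_pos fun i _ => Real.rpow_pos_of_pos (hE0 i) _)
        (Finset.prod_pos fun i _ => hE0 i), Real.log_prod fun i _ => (hE0 i).ne',
        Real.log_prod fun i _ => (Real.rpow_pos_of_pos (hE0 i) _).ne',
        Finset.sum_congr rfl fun i _ => Real.log_rpow (hE0 i) _]
      simpa using hle
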